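/- Consider the full-feedback best-of-$k$-actions online learning game with $n$ actions and $T$ rounds, where $1\le k\le n$. In each round $t=1,\dots,T$ a randomized player chooses a $k$-subset $S_t\subseteq\{1,\dots,n\}$, drawn from a probability distribution that may depend on all earlier loss vectors and on the player's own earlier choices; then the whole loss vector $\ell_t\in[0,1]^n$ is revealed and the player pays $\min_{i\in S_t}\ell_t(i)$. The minimax regret is $$R_T(n,k)=\inf_{\text{players}}\ \sup_{\ell_1,\dots,\ell_T\in[0,1]^n}\left(\mathbb E\Big[\sum_{t=1}^T\min_{i\in S_t}\ell_t(i)\Big]-\min_{|S|=k}\sum_{t=1}^T\min_{i\in S}\ell_t(i)\right).$$ Then $R_T(n,k)=\Theta\big(\sqrt{kT\log(n/k)}\big)$ in the following sense. (Upper bound) There is a universal constant $C>0$ such that for all $1\le k\le n$ and all $T\ge 0$, $$R_T(n,k)\le C\sqrt{kT\log(n/k)}.$$ (Lower bound) For every $\rho>1$ there is a constant $c>0$, depending only on $\rho$, such that for all $k\ge1$, $n\ge\rho k$ and $T\ge k\log(n/k)$, $$R_T(n,k)\ge c\sqrt{kT\log(n/k)}.$$ -/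

import Mathlib

noncomputable section

namespace BestOfK

/-- The `k`-element subsets of the `n` actions. -/
abbrev KSubset (n k : ℕ) : Type := {S : Finset (Fin n) // S.card = k}

/-- A loss vector assigns a loss in `[0, 1]` to each of the `n` actions. -/
abbrev LossVector (n : ℕ) : Type := Fin n → Set.Icc (0 : ℝ) 1

/-- The loss of playing the set `S`: the minimum of the losses of its actions
(an infimum over a finite set, nonempty when `1 ≤ k`). -/
def setLoss {n k : ℕ} (v : LossVector n) (S : KSubset n k) : ℝ :=
  ⨅ i : {i : Fin n // i ∈ S.1}, (v i.1 : ℝ)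

/-- The first `t` entries of a sequence of length `T`, where `t < T`. -/
def past {α : Type} {T : ℕ} (x : Fin T → α) (t : Fin T) : Fin (t : ℕ) → α :=
  fun r => x (Fin.castLE t.isLt.le r)

/-- A randomized full-feedback player for `T` rounds: in round `t`, given the loss vectors of all
earlier rounds and the sets it has itself played in them, it chooses the probability
distribution from which its `k`-subset for round `t` is drawn. -/
abbrev Player (n k T : ℕ) : Type :=
  (t : Fin T) → (Fin (t : ℕ) → LossVector n) → (Fin (t : ℕ) → KSubset n k) →
    stdSimplex ℝ (KSubset n k)

/-- The probability that the player `σ` plays the sets `s 0, s 1, …` when the loss sequence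
is `ℓ`. -/
def playProb {n k T : ℕ} (σ : Player n k T) (ℓ : Fin T → LossVector n)
    (s : Fin T → KSubset n k) : ℝ :=
  ∏ t : Fin T, (σ t (past ℓ t) (past s t)).1 (s t)

/-- The expected total loss of the player `σ` on the loss sequence `ℓ`. -/
def expectedLoss {n k T : ℕ} (σ : Player n k T) (ℓ : Fin T → LossVector n) : ℝ :=
  ∑ s : Fin T → KSubset n k, playProb σ ℓ s * ∑ t : Fin T, setLoss (ℓ t) (s t)

/-- The total loss of the best static `k`-subset in hindsight. -/
def bestStaticLoss {n T : ℕ} (k : ℕ) (ℓ : Fin T → LossVector n) : ℝ :=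
  ⨅ S : KSubset n k, ∑ t : Fin T, setLoss (ℓ t) S

/-- The expected regret of `σ` on the loss sequence `ℓ`. -/
def regret {n k T : ℕ} (σ : Player n k T) (ℓ : Fin T → LossVector n) : ℝ :=
  expectedLoss σ ℓ - bestStaticLoss k ℓ

/-- The minimax regret: the infimum over randomized players of the worst-case expected regret.
For `1 ≤ k ≤ n` the supremum is over a bounded nonempty set contained in `(-∞, T]`, and is
nonnegative (take all losses zero), so the infimum is also over a nonempty set bounded below. -/
def minimaxRegret (n k T : ℕ) : ℝ :=
  ⨅ σ : Player n k T, ⨆ ℓ : Fin T → LossVector n, regret σ ℓ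

end BestOfK

end

noncomputable section

namespace BestOfK

open scoped BigOperators

/-! ### Basic bounds on losses and regret -/

section Basic

variable {n k T : ℕ}

/-! Upper bound: run exponential weights with the `k`-subsets as experts, on losses from which each
round's smallest action loss has been subtracted. This shift does not change regret. A uniformly
random `k`-subset misses a fixed minimiser with probability `(n - k) / n`, so some set has total
excess at most `T (n - k) / n`. The first-order bound `gibbs_regret_le` then gives `2 η T (n - k) /
n + 2 log (n.choose k) / η`. The factor `(n - k) / n` is what keeps the constant universal as `n /
k` tends to `1`: it cancels the surplus logarithm in `log (n.choose (n - k))`.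

Lower bound: split the actions into `k` residue blocks. In each round activate one uniformly random
block, give its actions fair-coin losses, and give all other actions loss `1`. Each action then has
loss `0` with probability `1 / (2k)`, so by a union bound every `k`-subset, hence every player,
loses at least `1 / 2` per round on average. In hindsight one takes the best action of each block
and gains half the maximum of about `n / k` independent random walks of about `T / k` steps. Such a
maximum has mean of order `√((T / k) log (n / k))` (`le_expect_sup'_walk`, through Paley-Zygmund
applied to `exp (η * walk)`); summing over the blocks gives the rate. -/

theorem nonempty_kSubset (hkn : k ≤ n) : Nonempty (KSubset n k) := by
  obtain ⟨S, -, hS⟩ := Finset.exists_subset_card_eq (s := (Finset.univ : Finset (Fin n)))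
    (n := k) (by simpa using hkn)
  exact ⟨⟨S, hS⟩⟩

theorem setLoss_le (v : LossVector n) (S : KSubset n k) {i : Fin n} (hi : i ∈ S.1) :
    setLoss v S ≤ v i :=
  ciInf_le (f := fun j : {j : Fin n // j ∈ S.1} => (v j.1 : ℝ))
    (Set.finite_range _).bddBelow ⟨i, hi⟩

theorem nonempty_coe_kSubset (hk : 1 ≤ k) (S : KSubset n k) :
    Nonempty {i : Fin n // i ∈ S.1} := by
  have : S.1.Nonempty := Finset.card_pos.1 (by rw [S.2]; omega)
  exact ⟨⟨this.choose, this.choose_spec⟩⟩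

theorem le_setLoss (hk : 1 ≤ k) (v : LossVector n) (S : KSubset n k) {a : ℝ}
    (h : ∀ i ∈ S.1, a ≤ v i) : a ≤ setLoss v S := by
  have := nonempty_coe_kSubset hk S
  exact le_ciInf fun i => h i.1 i.2

theorem setLoss_nonneg (v : LossVector n) (S : KSubset n k) : 0 ≤ setLoss v S :=
  Real.iInf_nonneg fun i => (v i.1).2.1

theorem setLoss_le_one (hk : 1 ≤ k) (v : LossVector n) (S : KSubset n k) : setLoss v S ≤ 1 := by
  obtain ⟨i⟩ := nonempty_coe_kSubset hk S
  exact (setLoss_le v S i.2).trans (v i.1).2.2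

theorem playProb_nonneg (σ : Player n k T) (ℓ : Fin T → LossVector n) (s : Fin T → KSubset n k) :
    0 ≤ playProb σ ℓ s :=
  Finset.prod_nonneg fun t _ => (σ t _ _).2.1 _

theorem playProb_le_one (σ : Player n k T) (ℓ : Fin T → LossVector n)
    (s : Fin T → KSubset n k) : playProb σ ℓ s ≤ 1 := by
  refine Finset.prod_le_one (fun t _ => (σ t _ _).2.1 _) fun t _ => ?_
  rw [← (σ t (past ℓ t) (past s t)).2.2]
  exact Finset.single_le_sum (fun S _ => (σ t _ _).2.1 S) (Finset.mem_univ _)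

theorem bestStaticLoss_nonneg (ℓ : Fin T → LossVector n) : 0 ≤ bestStaticLoss k ℓ :=
  Real.iInf_nonneg fun _ => Finset.sum_nonneg fun _ _ => setLoss_nonneg _ _

theorem bestStaticLoss_le (ℓ : Fin T → LossVector n) (S : KSubset n k) :
    bestStaticLoss k ℓ ≤ ∑ t, setLoss (ℓ t) S :=
  ciInf_le (f := fun S : KSubset n k => ∑ t, setLoss (ℓ t) S) (Set.finite_range _).bddBelow S

theorem expectedLoss_nonneg (σ : Player n k T) (ℓ : Fin T → LossVector n) :
    0 ≤ expectedLoss σ ℓ :=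
  Finset.sum_nonneg fun _ _ => mul_nonneg (playProb_nonneg _ _ _)
    (Finset.sum_nonneg fun _ _ => setLoss_nonneg _ _)

theorem bddAbove_regret (hk : 1 ≤ k) (σ : Player n k T) :
    BddAbove (Set.range fun ℓ : Fin T → LossVector n => regret σ ℓ) := by
  refine ⟨∑ _s : Fin T → KSubset n k, (1 * ∑ _t : Fin T, 1 : ℝ), ?_⟩
  rintro _ ⟨ℓ, rfl⟩
  refine (sub_le_self _ (bestStaticLoss_nonneg ℓ)).trans ?_
  refine Finset.sum_le_sum fun s _ => ?_
  exact mul_le_mul (playProb_le_one _ _ _)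
    (Finset.sum_le_sum fun t _ => setLoss_le_one hk _ _)
    (Finset.sum_nonneg fun _ _ => setLoss_nonneg _ _) zero_le_one

theorem minimaxRegret_le (hk : 1 ≤ k) (σ : Player n k T) {B : ℝ}
    (h : ∀ ℓ, regret σ ℓ ≤ B) : minimaxRegret n k T ≤ B := by
  -- A real infimum is informative only over a set bounded below; this fixed loss sequence supplies
  -- one lower bound valid for all players.
  let ℓ₀ : Fin T → LossVector n := fun _ _ => ⟨0, by simp⟩
  refine ciInf_le_of_le ⟨-bestStaticLoss k ℓ₀, ?_⟩ σ (ciSup_le h)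
  rintro _ ⟨τ, rfl⟩
  refine le_trans ?_ (le_ciSup (bddAbove_regret hk τ) ℓ₀)
  have := expectedLoss_nonneg τ ℓ₀
  unfold regret
  linarith

end Basic

/-! ### Players that ignore their own past choices -/

section Oblivious

theorem sum_prod_mul_eval {ι E : Type*} [Fintype ι] [DecidableEq ι] [Fintype E]
    (p : ι → E → ℝ) (hp : ∀ i, ∑ e, p i e = 1) (f : E → ℝ) (i : ι) :
    ∑ s : ι → E, (∏ j, p j (s j)) * f (s i) = ∑ e, p i e * f e := by
  have h1 : ∀ s : ι → E, (∏ j, p j (s j)) * f (s i)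
      = ∏ j, p j (s j) * (if j = i then f (s j) else 1) := fun s => by
    rw [Finset.prod_mul_distrib, Finset.prod_ite_eq' Finset.univ i fun j => f (s j)]
    simp
  simp_rw [h1]
  rw [← Fintype.piFinset_univ,
    ← Finset.prod_univ_sum (fun _ => Finset.univ) fun j e => p j e * (if j = i then f e else 1),
    ← Finset.mul_prod_erase _ _ (Finset.mem_univ i)]
  rw [Finset.prod_eq_one (s := Finset.univ.erase i), mul_one]
  · simp
  · intro j hj
    simp [Finset.ne_of_mem_erase hj, hp]

variable {n k T : ℕ}

theorem expectedLoss_of_oblivious (σ : Player n k T) (ℓ : Fin T → LossVector n)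
    (p : Fin T → KSubset n k → ℝ) (hp : ∀ t s, (σ t (past ℓ t) s).1 = p t)
    (hp1 : ∀ t, ∑ S, p t S = 1) :
    expectedLoss σ ℓ = ∑ t, ∑ S, p t S * setLoss (ℓ t) S := by
  simp only [expectedLoss, playProb, hp, Finset.mul_sum]
  rw [Finset.sum_comm]
  exact Finset.sum_congr rfl fun t _ => sum_prod_mul_eval p hp1 _ t

end Oblivious

/-! ### Exponential weights -/

section Hedge

variable {E : Type*} [Fintype E] [Nonempty E]

/-- The distribution proportional to `exp (-η * L e)`. -/
def gibbs (η : ℝ) (L : E → ℝ) : stdSimplex ℝ E :=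
  ⟨fun e => Real.exp (-η * L e) / ∑ e', Real.exp (-η * L e'),
    fun e => by positivity,
    by
      rw [← Finset.sum_div]
      exact div_self (Finset.sum_pos (fun _ _ => Real.exp_pos _) Finset.univ_nonempty).ne'⟩

/-- Combines `exp (-x) ≤ 1 - x + x ^ 2` with `c ^ 2 ≤ c`. Keeping the error linear in `c` is what
makes the regret bound first-order. -/
theorem exp_neg_mul_le {η c : ℝ} (h0 : 0 ≤ η) (h1 : η ≤ 1) (hc : 0 ≤ c) (hc1 : c ≤ 1) :
    Real.exp (-(η * c)) ≤ 1 - (η - η ^ 2) * c := by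
  have hx : 0 ≤ η * c := mul_nonneg h0 hc
  have hx1 : η * c ≤ 1 := by nlinarith
  have h := (abs_le.1 (Real.abs_exp_sub_one_sub_id_le (x := -(η * c))
    (by rw [abs_neg, abs_of_nonneg hx]; exact hx1))).2
  nlinarith [mul_nonneg (sq_nonneg η) (mul_nonneg hc (sub_nonneg.2 hc1))]

theorem sum_exp_le (c : ℕ → E → ℝ) (h0 : ∀ t e, 0 ≤ c t e) (h1 : ∀ t e, c t e ≤ 1) {η : ℝ}
    (hη : 0 ≤ η) (hη1 : η ≤ 1) (m : ℕ) :
    ∑ e, Real.exp (-η * ∑ r ∈ Finset.range m, c r e) ≤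
      Fintype.card E * Real.exp (-(η - η ^ 2) * ∑ t ∈ Finset.range m,
        ∑ e, (gibbs η fun e => ∑ r ∈ Finset.range t, c r e).1 e * c t e) := by
  induction m with
  | zero => simp
  | succ m ih =>
    set W := ∑ e, Real.exp (-η * ∑ r ∈ Finset.range m, c r e) with hW
    set q := ∑ e, (gibbs η fun e => ∑ r ∈ Finset.range m, c r e).1 e * c m e with hq
    have hWpos : 0 < W := Finset.sum_pos (fun _ _ => Real.exp_pos _) Finset.univ_nonempty
    have hqW : W * q = ∑ e, Real.exp (-η * ∑ r ∈ Finset.range m, c r e) * c m e := by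
      rw [hq, Finset.mul_sum]
      refine Finset.sum_congr rfl fun e _ => ?_
      change W * (_ / W * _) = _
      field_simp
    calc ∑ e, Real.exp (-η * ∑ r ∈ Finset.range (m + 1), c r e)
        = ∑ e, Real.exp (-η * ∑ r ∈ Finset.range m, c r e) * Real.exp (-(η * c m e)) := by
          refine Finset.sum_congr rfl fun e _ => ?_
          rw [← Real.exp_add, Finset.sum_range_succ]
          ring_nf
      _ ≤ ∑ e, Real.exp (-η * ∑ r ∈ Finset.range m, c r e) * (1 - (η - η ^ 2) * c m e) :=
          Finset.sum_le_sum fun e _ => mul_le_mul_of_nonneg_left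
            (exp_neg_mul_le hη hη1 (h0 m e) (h1 m e)) (Real.exp_pos _).le
      _ = W * (1 + -(η - η ^ 2) * q) := by
          rw [mul_add, mul_left_comm, hqW, Finset.mul_sum, hW, mul_one, ← Finset.sum_add_distrib]
          refine Finset.sum_congr rfl fun e _ => ?_
          ring
      _ ≤ W * Real.exp (-(η - η ^ 2) * q) := by
          gcongr
          linarith [Real.add_one_le_exp (-(η - η ^ 2) * q)]
      _ ≤ _ := by
          rw [Finset.sum_range_succ, mul_add, Real.exp_add, ← mul_assoc]
          gcongr

/-- First-order regret bound for exponential weights. -/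
theorem gibbs_regret_le (c : ℕ → E → ℝ) (h0 : ∀ t e, 0 ≤ c t e) (h1 : ∀ t e, c t e ≤ 1) {η : ℝ}
    (hη : 0 < η) (hη1 : η ≤ 1 / 2) (T : ℕ) (e : E) :
    ∑ t ∈ Finset.range T, ∑ e, (gibbs η fun e => ∑ r ∈ Finset.range t, c r e).1 e * c t e ≤
      ∑ t ∈ Finset.range T, c t e + (2 * η * ∑ t ∈ Finset.range T, c t e
        + 2 * Real.log (Fintype.card E) / η) := by
  set A := ∑ t ∈ Finset.range T, ∑ e, (gibbs η fun e => ∑ r ∈ Finset.range t, c r e).1 e * c t e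
  set L := ∑ t ∈ Finset.range T, c t e with hL
  have hN : (1 : ℝ) ≤ Fintype.card E := by exact_mod_cast Fintype.card_pos
  have hlog := Real.log_nonneg hN
  have hL0 : 0 ≤ L := Finset.sum_nonneg fun _ _ => h0 _ _
  have h : Real.exp (-η * L) ≤ Fintype.card E * Real.exp (-(η - η ^ 2) * A) :=
    (Finset.single_le_sum (f := fun e => Real.exp (-η * ∑ t ∈ Finset.range T, c t e))
      (fun _ _ => (Real.exp_pos _).le) (Finset.mem_univ e)).trans
      (sum_exp_le c h0 h1 hη.le (by linarith) T)
  rw [← Real.exp_log (by linarith : (0 : ℝ) < Fintype.card E), ← Real.exp_add,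
    Real.exp_le_exp] at h
  set l := Real.log (Fintype.card E)
  have h2 : (1 - η) * A ≤ L + l / η := by
    rw [← sub_nonneg]
    have : L + l / η - (1 - η) * A = (l + η * L - (η - η ^ 2) * A) / η := by
      field_simp
      ring
    rw [this]
    exact div_nonneg (by linarith) hη.le
  have hlη : 0 ≤ l / η := div_nonneg hlog hη.le
  -- For `0 ≤ η ≤ 1 / 2`, `1 ≤ (1 - η) * (1 + 2 * η)`.
  have h3 : A ≤ (1 + 2 * η) * (L + l / η) := by
    have : L + l / η ≤ (1 - η) * ((1 + 2 * η) * (L + l / η)) := by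
      nlinarith [mul_nonneg (mul_nonneg hη.le (by linarith : 0 ≤ 1 - 2 * η))
        (add_nonneg hL0 hlη)]
    exact le_of_mul_le_mul_left (h2.trans this) (by linarith)
  have h4 : 2 * l / η = 2 * (l / η) := by ring
  rw [h4]
  nlinarith [mul_nonneg hlη (by linarith : 0 ≤ 1 - 2 * η)]

end Hedge

/-! ### Excess losses -/

section Excess

variable {n k T : ℕ}

/-- The loss of `S` in excess of the loss of the best action. -/
def excessLoss (v : LossVector n) (S : KSubset n k) : ℝ := setLoss v S - ⨅ i, (v i : ℝ)

theorem iInf_le_coe (v : LossVector n) (i : Fin n) : ⨅ i, (v i : ℝ) ≤ v i :=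
  ciInf_le (f := fun i => (v i : ℝ)) (Set.finite_range _).bddBelow i

theorem excessLoss_nonneg (hk : 1 ≤ k) (v : LossVector n) (S : KSubset n k) :
    0 ≤ excessLoss v S :=
  sub_nonneg.2 (le_setLoss hk v S fun i _ => iInf_le_coe v i)

theorem excessLoss_le_one (hk : 1 ≤ k) (v : LossVector n) (S : KSubset n k) :
    excessLoss v S ≤ 1 :=
  (sub_le_self _ (Real.iInf_nonneg fun i => (v i).2.1)).trans (setLoss_le_one hk v S)

theorem card_kSubset : Fintype.card (KSubset n k) = n.choose k := by
  rw [Fintype.card_subtype]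
  have : (Finset.univ.filter fun S : Finset (Fin n) => S.card = k)
      = Finset.univ.powersetCard k := by
    ext S; simp
  rw [this, Finset.card_powersetCard, Finset.card_univ, Fintype.card_fin]

theorem card_kSubset_not_mem (i : Fin n) :
    (Finset.univ.filter fun S : KSubset n k => i ∉ S.1).card = (n - 1).choose k := by
  have : ((Finset.univ.filter fun S : KSubset n k => i ∉ S.1).map
      (Function.Embedding.subtype _)) = (Finset.univ.erase i).powersetCard k := by
    ext S
    simp [Finset.mem_powersetCard, Finset.subset_erase, and_comm]
  rw [← Finset.card_map, this, Finset.card_powersetCard, Finset.card_erase_of_mem (by simp)]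
  simp

/-- The excess vanishes on every set containing a minimising action and is at most `1` on the
others, whose proportion is `(n - k) / n`. -/
theorem sum_excessLoss_le (hk : 1 ≤ k) (hkn : k ≤ n) (v : LossVector n) :
    ∑ S : KSubset n k, excessLoss v S ≤ n.choose k * (((n - k : ℕ) : ℝ) / n) := by
  have hn : 0 < n := by omega
  have : Nonempty (Fin n) := ⟨⟨0, hn⟩⟩
  obtain ⟨i, hi⟩ := Finite.exists_min fun i => (v i : ℝ)
  have hmin : (v i : ℝ) ≤ ⨅ i, (v i : ℝ) := le_ciInf hi
  have h1 : ∀ S : KSubset n k, excessLoss v S ≤ if i ∉ S.1 then 1 else 0 := fun S => by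
    by_cases h : i ∈ S.1
    · have := setLoss_le v S h
      rw [if_neg (not_not.2 h)]
      unfold excessLoss
      linarith
    · rw [if_pos h]
      exact excessLoss_le_one hk v S
  refine (Finset.sum_le_sum fun S _ => h1 S).trans ?_
  rw [Finset.sum_boole, card_kSubset_not_mem, ← mul_div_assoc, le_div_iff₀ (by positivity)]
  have := Nat.choose_mul_succ_eq (n - 1) k
  rw [Nat.sub_add_cancel hn] at this
  exact_mod_cast this.le

theorem card_kSubset_pos [Nonempty (KSubset n k)] : (0 : ℝ) < n.choose k := by
  rw [← card_kSubset]
  exact_mod_cast Fintype.card_pos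

theorem sum_sum_excessLoss_le (hk : 1 ≤ k) (hkn : k ≤ n) (ℓ : Fin T → LossVector n) :
    ∑ t, ∑ S : KSubset n k, excessLoss (ℓ t) S
      ≤ n.choose k * (T * (((n - k : ℕ) : ℝ) / n)) := by
  refine (Finset.sum_le_sum fun t _ => sum_excessLoss_le hk hkn (ℓ t)).trans ?_
  simp only [Finset.sum_const, Finset.card_univ, Fintype.card_fin, nsmul_eq_mul]
  exact le_of_eq (by ring)

/-- The player running exponential weights on the `k`-subsets. -/
def hedgePlayer [Nonempty (KSubset n k)] (η : ℝ) : Player n k T :=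
  fun _ hist _ => gibbs η fun S => ∑ r, excessLoss (hist r) S

theorem regret_hedgePlayer_le [Nonempty (KSubset n k)] (hk : 1 ≤ k) (hkn : k ≤ n) {η : ℝ}
    (ℓ : Fin T → LossVector n) :
    ∃ S : KSubset n k, ∑ t, excessLoss (ℓ t) S ≤ T * (((n - k : ℕ) : ℝ) / n) ∧
      regret (hedgePlayer (k := k) η) ℓ ≤
        ∑ t, ∑ S : KSubset n k, (gibbs η fun S => ∑ r, excessLoss (past ℓ t r) S).1 S
          * excessLoss (ℓ t) S - ∑ t, excessLoss (ℓ t) S := by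
  obtain ⟨S, hS⟩ := Finite.exists_min fun S : KSubset n k => ∑ t, excessLoss (ℓ t) S
  refine ⟨S, ?_, ?_⟩
  · refine le_of_mul_le_mul_left ?_ (card_kSubset_pos (n := n) (k := k))
    refine le_trans ?_ (sum_sum_excessLoss_le hk hkn ℓ)
    rw [Finset.sum_comm, ← card_kSubset, ← nsmul_eq_mul, ← Finset.card_univ]
    exact Finset.card_nsmul_le_sum _ _ _ fun S' _ => hS S'
  · have hset : ∀ t (S : KSubset n k),
        setLoss (ℓ t) S = excessLoss (ℓ t) S + ⨅ i, (ℓ t i : ℝ) := fun t S => by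
      simp [excessLoss]
    have h1 : ∑ t, excessLoss (ℓ t) S + ∑ t, ⨅ i, (ℓ t i : ℝ) ≤ bestStaticLoss k ℓ := by
      refine le_ciInf fun S' => ?_
      simp_rw [hset, Finset.sum_add_distrib]
      exact add_le_add_left (hS S') _
    unfold regret
    rw [expectedLoss_of_oblivious (hedgePlayer η) ℓ
      (fun t => (gibbs η fun S => ∑ r, excessLoss (past ℓ t r) S).1) (fun _ _ => rfl)
      fun t => (gibbs η _).2.2]
    have h2 : ∀ t, ∑ S : KSubset n k, (gibbs η fun S => ∑ r, excessLoss (past ℓ t r) S).1 S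
          * setLoss (ℓ t) S
        = ∑ S : KSubset n k, (gibbs η fun S => ∑ r, excessLoss (past ℓ t r) S).1 S
          * excessLoss (ℓ t) S + ⨅ i, (ℓ t i : ℝ) := fun t => by
      simp_rw [hset, mul_add, Finset.sum_add_distrib, ← Finset.sum_mul]
      rw [(gibbs η _).2.2, one_mul]
    simp_rw [h2, Finset.sum_add_distrib]
    linarith

/-- With `η = 0` the player is uniform on `k`-subsets. This covers the short horizons for which the
optimal `η` would exceed `1 / 2`. -/
theorem minimaxRegret_le_mul (hk : 1 ≤ k) (hkn : k ≤ n) :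
    minimaxRegret n k T ≤ T * (((n - k : ℕ) : ℝ) / n) := by
  have := nonempty_kSubset hkn
  refine minimaxRegret_le hk (hedgePlayer 0) fun ℓ => ?_
  obtain ⟨S, -, h⟩ := regret_hedgePlayer_le hk hkn (η := 0) ℓ
  refine h.trans ((sub_le_self _ (Finset.sum_nonneg fun t _ =>
    excessLoss_nonneg hk _ _)).trans ?_)
  simp only [gibbs, neg_zero, zero_mul, Real.exp_zero, Finset.sum_const, Finset.card_univ,
    nsmul_eq_mul, mul_one, card_kSubset, ← Finset.mul_sum]
  rw [one_div, inv_mul_le_iff₀ card_kSubset_pos]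
  exact sum_sum_excessLoss_le hk hkn ℓ

theorem minimaxRegret_le_of_hedge (hk : 1 ≤ k) (hkn : k ≤ n) {η : ℝ} (hη : 0 < η)
    (hη1 : η ≤ 1 / 2) :
    minimaxRegret n k T ≤
      2 * η * (T * (((n - k : ℕ) : ℝ) / n)) + 2 * Real.log (n.choose k) / η := by
  have := nonempty_kSubset hkn
  refine minimaxRegret_le hk (hedgePlayer η) fun ℓ => ?_
  obtain ⟨S, hS, h⟩ := regret_hedgePlayer_le hk hkn (η := η) ℓ
  -- Padding by zero after round `T` gives the sequence indexed by `ℕ` that the exponential weights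
  -- bound expects.
  let c : ℕ → KSubset n k → ℝ := fun r S => if h : r < T then excessLoss (ℓ ⟨r, h⟩) S else 0
  have hc0 : ∀ t e, 0 ≤ c t e := fun t e => by
    dsimp only [c]
    split_ifs
    exacts [excessLoss_nonneg hk _ _, le_rfl]
  have hc1 : ∀ t e, c t e ≤ 1 := fun t e => by
    dsimp only [c]
    split_ifs
    exacts [excessLoss_le_one hk _ _, zero_le_one]
  have hg := gibbs_regret_le c hc0 hc1 hη hη1 T S
  have hcF : ∀ (t : Fin T) (S : KSubset n k), c t S = excessLoss (ℓ t) S := fun t S => by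
    simp [c]
  have hcP : ∀ (t : Fin T) (S : KSubset n k),
      ∑ r ∈ Finset.range t, c r S = ∑ r, excessLoss (past ℓ t r) S := fun t S => by
    rw [Finset.sum_range]
    exact Finset.sum_congr rfl fun r _ => hcF (Fin.castLE t.isLt.le r) S
  rw [Finset.sum_range, Finset.sum_range] at hg
  simp only [hcF, hcP] at hg
  rw [card_kSubset] at hg
  have := mul_le_mul_of_nonneg_left hS (by linarith : 0 ≤ 2 * η)
  linarith

end Excess

/-! ### Upper bound -/

section Upper

/-- Follows from `n.choose j ≤ n ^ j / j!` and `j ^ j / j! ≤ exp j`. -/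
theorem log_choose_le {n j : ℕ} (hj : 1 ≤ j) (hjn : j ≤ n) :
    Real.log (n.choose j) ≤ j * (1 + Real.log ((n : ℝ) / j)) := by
  have hj0 : (0 : ℝ) < j := by exact_mod_cast hj
  have hn0 : (0 : ℝ) < n := by exact_mod_cast (by omega : 0 < n)
  have h0 : (0 : ℝ) < n.choose j := by exact_mod_cast Nat.choose_pos hjn
  rw [Real.log_le_iff_le_exp h0, mul_add, mul_one, Real.exp_add, ← Real.log_pow,
    Real.exp_log (by positivity)]
  have h1 := Nat.choose_le_pow_div (α := ℝ) j n
  have h2 := Real.pow_div_factorial_le_exp (j : ℝ) hj0.le j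
  refine h1.trans ?_
  rw [div_pow, mul_div_assoc', le_div_iff₀ (by positivity)]
  calc (n : ℝ) ^ j / j.factorial * j ^ j = j ^ j / j.factorial * n ^ j := by ring
    _ ≤ _ := by gcongr

theorem mul_one_sub_log_le {x : ℝ} (hx : 0 < x) : x * (1 + Real.log (1 / x)) ≤ 1 := by
  have := Real.log_le_sub_one_of_pos (by positivity : 0 < 1 / x)
  calc x * (1 + Real.log (1 / x)) ≤ x * (1 / x) := by gcongr; linarith
    _ = 1 := by field_simp

/-- Optimising `η` in a bound of the form `2 η a + 2 b / η`, given the trivial bound `a`. -/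
theorem le_of_forall_eta {R a b D : ℝ} {T y : ℝ} (hT : 0 < T) (hD : 0 < D) (hy : 0 < y)
    (hRa : R ≤ a) (hR : ∀ η, 0 < η → η ≤ 1 / 2 → R ≤ 2 * η * a + 2 * b / η)
    (ha : a * y ≤ T) (hb : b ≤ 3 * (D * y)) :
    R ≤ 8 * Real.sqrt (D * T) := by
  have hDT : 0 < Real.sqrt (D * T) := Real.sqrt_pos.2 (by positivity)
  have hsq : Real.sqrt (D * T) ^ 2 = D * T := Real.sq_sqrt (by positivity)
  set s := Real.sqrt (D * T)
  have ha' : a ≤ T / y := by rwa [le_div_iff₀ hy]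
  -- The choice `η = s * y / T` balances the two terms, with `s = √(D * T)`. If it is not
  -- admissible, then `T / y ≤ 2 * s` and the trivial bound suffices.
  rcases le_total (s * y / T) (1 / 2) with h | h
  · refine (hR (s * y / T) (by positivity) h).trans ?_
    have e1 : 2 * (s * y / T) * a = 2 * s * (a * y / T) := by ring
    have e2 : 2 * b / (s * y / T) ≤ 6 * s := by
      rw [div_le_iff₀ (by positivity)]
      calc 2 * b ≤ 6 * (D * y) := by linarith
        _ = 6 * (D * T) * y / T := by field_simp
        _ = _ := by rw [← hsq]; ring
    have e3 : a * y / T ≤ 1 := by rwa [div_le_one hT]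
    rw [e1]
    nlinarith
  · refine hRa.trans (ha'.trans ?_)
    rw [div_le_iff₀ hy]
    rw [le_div_iff₀ hT] at h
    nlinarith [mul_pos hDT hy]

theorem minimaxRegret_le_sqrt {n k T : ℕ} (hk : 1 ≤ k) (hkn : k ≤ n) :
    minimaxRegret n k T ≤ 16 * Real.sqrt (k * T * Real.log ((n : ℝ) / k)) := by
  have hk0 : (0 : ℝ) < k := by exact_mod_cast hk
  have hn0 : (0 : ℝ) < n := by exact_mod_cast (by omega : 0 < n)
  have hkn' : (k : ℝ) ≤ n := by exact_mod_cast hkn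
  have h0 := minimaxRegret_le_mul (T := T) hk hkn
  have hη := fun η h1 h2 => minimaxRegret_le_of_hedge (T := T) hk hkn (η := η) h1 h2
  have hlog0 : 0 ≤ Real.log ((n : ℝ) / k) := Real.log_nonneg (by rwa [one_le_div hk0])
  rcases Nat.eq_zero_or_pos T with rfl | hT
  · refine h0.trans ?_
    simp
  rcases hkn.eq_or_lt with rfl | hlt
  · refine h0.trans ?_
    simp
  have hT0 : (0 : ℝ) < T := by exact_mod_cast hT
  have hsub : ((n - k : ℕ) : ℝ) = n - k := by push_cast [hkn]; ring
  have hm0 : (0 : ℝ) < (n - k : ℕ) := by exact_mod_cast (by omega : 0 < n - k)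
  set m := n - k with hm
  set R := minimaxRegret n k T
  have hprod : (k : ℝ) * T * Real.log ((n : ℝ) / k) = k * Real.log ((n : ℝ) / k) * T := by ring
  rw [hprod]
  rcases le_total (2 * k) n with h2 | h2
  · have h2' : (2 : ℝ) ≤ (n : ℝ) / k := by rw [le_div_iff₀ hk0]; exact_mod_cast h2
    have hl : Real.log 2 ≤ Real.log ((n : ℝ) / k) := Real.log_le_log (by norm_num) h2'
    -- Since `2 * log 2 > 1`, here `1 + log (n / k) ≤ 3 * log (n / k)`.
    have hl2 := Real.log_two_gt_d9
    refine (le_of_forall_eta (y := 1) hT0 (D := k * Real.log ((n : ℝ) / k)) (by nlinarith)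
      one_pos h0 hη ?_ ?_).trans ?_
    · rw [mul_one]
      have : (m : ℝ) / n ≤ 1 := by rw [div_le_one hn0]; linarith
      nlinarith
    · refine (log_choose_le hk hkn).trans ?_
      nlinarith
    · linarith [Real.sqrt_nonneg (k * Real.log ((n : ℝ) / k) * T)]
  -- For `n ≤ 2 * k` one counts complements, of size `m = n - k`. With `y = 1 + log (n / m)`, the
  -- excess bound satisfies `(T * m / n) * y ≤ T`, so the logarithm drops out and leaves `√(m * T)`;
  -- finally `m` is at most a multiple of `k * log (n / k)`.
  · have h2' : (n : ℝ) ≤ 2 * k := by exact_mod_cast h2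
    have hx : 0 < (m : ℝ) / n := by positivity
    have hmn : (m : ℝ) ≤ n := by linarith
    have hy : 0 < 1 + Real.log ((n : ℝ) / m) := by
      have := Real.log_nonneg ((one_le_div hm0).2 hmn)
      linarith
    have hxy := mul_one_sub_log_le hx
    rw [one_div_div] at hxy
    have h3 : R ≤ 8 * Real.sqrt (m * T) := by
      refine le_of_forall_eta hT0 hm0 hy h0 hη ?_ ?_
      · nlinarith
      · have := log_choose_le (n := n) (j := m) (by omega) (by omega)
        rw [hm, Nat.choose_symm hkn] at this
        have h4 : 0 < (m : ℝ) * (1 + Real.log ((n : ℝ) / m)) := by positivity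
        linarith
    have h5 : (m : ℝ) ≤ 4 * (k * Real.log ((n : ℝ) / k)) := by
      have := Real.one_sub_inv_le_log_of_pos (by positivity : 0 < (n : ℝ) / k)
      rw [inv_div] at this
      have h6 : (k : ℝ) * (1 - k / n) ≤ k * Real.log ((n : ℝ) / k) := by gcongr
      have h7 : (m : ℝ) ≤ 2 * (k * (1 - k / n)) := by
        have : 2 * ((k : ℝ) * (1 - k / n)) = 2 * k * m / n := by
          rw [hsub]; field_simp
        rw [this, le_div_iff₀ hn0]
        nlinarith
      nlinarith
    refine h3.trans ?_
    have : Real.sqrt (m * T) ≤ Real.sqrt (2 ^ 2 * (k * Real.log ((n : ℝ) / k) * T)) :=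
      Real.sqrt_le_sqrt (by nlinarith)
    rw [Real.sqrt_mul (by norm_num : (0 : ℝ) ≤ 2 ^ 2), Real.sqrt_sq (by norm_num)] at this
    linarith

end Upper

/-! ### Uniform averages -/

section Expect

theorem expect_pi_prod {ι E : Type*} [Fintype ι] [DecidableEq ι] [Fintype E] (f : ι → E → ℝ) :
    𝔼 x : ι → E, ∏ i, f i (x i) = ∏ i, 𝔼 e, f i e := by
  simp only [Fintype.expect_eq_sum_div_card, Finset.prod_div_distrib]
  rw [← Fintype.piFinset_univ, Finset.prod_univ_sum]
  simp

theorem expect_pi_eval {ι E : Type*} [Fintype ι] [DecidableEq ι] [Fintype E] [Nonempty E]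
    (i : ι) (f : E → ℝ) : 𝔼 x : ι → E, f (x i) = 𝔼 e, f e := by
  have h := expect_pi_prod fun j e => if j = i then f e else (1 : ℝ)
  have h1 : ∀ j, (𝔼 e, if j = i then f e else (1 : ℝ)) = if j = i then 𝔼 e, f e else 1 :=
    fun j => by split_ifs <;> simp
  simp_rw [h1] at h
  simpa using h

theorem expect_bool (f : Bool → ℝ) : 𝔼 b, f b = (f true + f false) / 2 := by
  rw [Fintype.expect_eq_sum_div_card, Fintype.sum_bool]
  simp

theorem expect_prod {E F : Type*} [Fintype E] [Fintype F] (f : E × F → ℝ) :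
    𝔼 x, f x = 𝔼 e, 𝔼 g, f (e, g) := by
  rw [← Finset.univ_product_univ, Finset.expect_product]

/-- The Paley-Zygmund inequality for a uniform average. -/
theorem paley_zygmund {Ω : Type*} [Fintype Ω] [Nonempty Ω] (Z : Ω → ℝ) {θ r : ℝ} (hθ0 : 0 ≤ θ)
    (hθ : θ ≤ 1)
    (hZ : 0 < 𝔼 ω, Z ω) (hQ : 0 < 𝔼 ω, Z ω ^ 2)
    (hr : r * 𝔼 ω, Z ω ^ 2 ≤ (𝔼 ω, Z ω) ^ 2) :
    (1 - θ) ^ 2 * r ≤ 𝔼 ω, if θ * (𝔼 ω, Z ω) ≤ Z ω then (1 : ℝ) else 0 := by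
  set μ := 𝔼 ω, Z ω with hμ
  set Q := 𝔼 ω, Z ω ^ 2 with hQ'
  set a := (1 - θ) * μ / Q with ha
  have ha0 : 0 ≤ a := div_nonneg (mul_nonneg (by linarith) hZ.le) hQ.le
  -- A quadratic minorant of the indicator, from `2 * u - u ^ 2 ≤ 1` with `u = a * Z ω`; the chosen
  -- `a` maximises its average.
  have h1 : ∀ ω, 2 * a * Z ω - 2 * a * (θ * μ) - a ^ 2 * Z ω ^ 2
      ≤ if θ * μ ≤ Z ω then (1 : ℝ) else 0 := fun ω => by
    split_ifs with h
    · nlinarith [sq_nonneg (a * Z ω - 1), mul_nonneg ha0 (mul_nonneg hθ0 hZ.le)]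
    · nlinarith [sq_nonneg (a * Z ω), mul_nonneg ha0 (sub_nonneg.2 (not_le.1 h).le)]
  have h2 := Finset.expect_le_expect (s := Finset.univ) fun ω _ => h1 ω
  simp only [Finset.expect_sub_distrib, ← Finset.mul_expect, ← hμ, ← hQ',
    Fintype.expect_const] at h2
  refine le_trans ?_ h2
  have h3 : 2 * a * μ - 2 * a * (θ * μ) - a ^ 2 * Q = (1 - θ) ^ 2 * (μ ^ 2 / Q) := by
    rw [ha]
    field_simp
    ring
  rw [h3]
  have : r ≤ μ ^ 2 / Q := by rwa [le_div_iff₀ hQ]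
  gcongr

end Expect

/-! ### Simple random walks -/

section Walk

variable {τ : Type*}

/-- The step of a simple random walk. -/
def sgn (b : Bool) : ℝ := if b then 1 else -1

/-- The sum of the steps of a walk over the times in `A`. -/
def walk (A : Finset τ) (e : τ → Bool) : ℝ := ∑ t ∈ A, sgn (e t)

variable [Fintype τ] [DecidableEq τ]

theorem expect_walk (A : Finset τ) : 𝔼 e, walk A e = 0 := by
  simp only [walk]
  rw [Finset.expect_sum_comm]
  refine Finset.sum_eq_zero fun t _ => ?_
  rw [expect_pi_eval, expect_bool]
  simp [sgn]

theorem expect_exp_walk (A : Finset τ) (η : ℝ) :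
    𝔼 e, Real.exp (η * walk A e) = Real.cosh η ^ A.card := by
  have h : ∀ e : τ → Bool, Real.exp (η * walk A e)
      = ∏ t, if t ∈ A then Real.exp (η * sgn (e t)) else 1 := fun e => by
    rw [walk, Finset.mul_sum, Real.exp_sum, Finset.prod_ite_mem, Finset.univ_inter]
  simp_rw [h]
  rw [expect_pi_prod fun t b => if t ∈ A then Real.exp (η * sgn b) else 1]
  have h1 : ∀ t, (𝔼 b, if t ∈ A then Real.exp (η * sgn b) else 1)
      = if t ∈ A then Real.cosh η else 1 := fun t => by
    split_ifs
    · rw [expect_bool, Real.cosh_eq]; simp [sgn]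
    · simp
  simp_rw [h1]
  simp

/-- With `u = exp (-η ^ 2)` and `C = cosh (2 * η)`, `cosh x ≤ exp (x ^ 2 / 2)` gives `u ^ 2 * C ≤
1`, so `u * C ≤ (u ^ 2 * C + C) / 2 ≤ (1 + C) / 2 = cosh η ^ 2`. This is the one-step second-moment
ratio for Paley-Zygmund. -/
theorem exp_neg_sq_mul_cosh_two_mul_le (η : ℝ) :
    Real.exp (-η ^ 2) * Real.cosh (2 * η) ≤ Real.cosh η ^ 2 := by
  have h1 := Real.cosh_le_exp_half_sq (2 * η)
  have h2 : Real.cosh (2 * η) = 2 * Real.cosh η ^ 2 - 1 := by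
    rw [Real.cosh_two_mul, Real.sinh_sq]; ring
  have h3 : Real.exp (-η ^ 2) ^ 2 * Real.cosh (2 * η) ≤ 1 := by
    calc _ ≤ Real.exp (-η ^ 2) ^ 2 * Real.exp ((2 * η) ^ 2 / 2) := by gcongr
      _ = 1 := by rw [← Real.exp_nat_mul, ← Real.exp_add]; simp; ring
  have h4 := Real.one_le_cosh (2 * η)
  nlinarith [mul_nonneg (sq_nonneg (Real.exp (-η ^ 2) - 1)) (by linarith : 0 ≤ Real.cosh (2 * η))]

theorem div_le_log_cosh {η : ℝ} (hη : 0 ≤ η) : η ^ 2 / (2 + η ^ 2) ≤ Real.log (Real.cosh η) := by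
  have h : 1 + η ^ 2 / 2 ≤ Real.cosh η := by
    have h1 := Real.self_le_sinh_iff.2 (by positivity : 0 ≤ η / 2)
    have h2 := Real.cosh_two_mul (η / 2)
    rw [Real.cosh_sq, mul_div_cancel₀ _ (by norm_num)] at h2
    nlinarith
  refine le_trans ?_ (Real.log_le_log (by positivity) h)
  have := Real.one_sub_inv_le_log_of_pos (by positivity : 0 < 1 + η ^ 2 / 2)
  refine le_trans (le_of_eq ?_) this
  field_simp
  ring

/-- Paley-Zygmund for `exp (η * walk A e)` with `η ^ 2 = L / N`: the moment ratio is at least `exp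
(-L) = 1 / (e * b)`, and `θ = 10 / 11` with `e < 3` yields `363 = 3 * 11 ^ 2`. On the event, `η *
walk ≥ N * log (cosh η) + log (10 / 11) ≥ L / 5 - 1 / 10 ≥ L / 10`. -/
theorem anticoncentration_walk (A : Finset τ) {b : ℝ} (hb : 1 ≤ b) (hA : 1 ≤ A.card)
    (hbA : Real.log b ≤ 2 * A.card) :
    1 / (363 * b) ≤
      𝔼 e, if Real.sqrt (A.card * (Real.log b + 1)) / 10 ≤ walk A e then (1 : ℝ) else 0 := by
  set N : ℝ := (A.card : ℝ) with hN
  have hN1 : 1 ≤ N := by rw [hN]; exact_mod_cast hA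
  set L := Real.log b + 1 with hL
  have hL1 : 1 ≤ L := by linarith [Real.log_nonneg hb]
  set η := Real.sqrt (L / N) with hη
  have hη0 : 0 < η := Real.sqrt_pos.2 (by positivity)
  have hη2 : η ^ 2 = L / N := Real.sq_sqrt (by positivity)
  have hNη : N * η ^ 2 = L := by rw [hη2]; field_simp
  have hη3 : η ^ 2 ≤ 3 := by rw [hη2, div_le_iff₀ (by positivity)]; linarith
  have hsqrt : Real.sqrt (N * L) = N * η := by
    rw [Real.sqrt_eq_iff_mul_self_eq (by positivity) (by positivity)]
    nlinarith
  have hcosh : 0 < Real.cosh η := Real.cosh_pos η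
  have hE := expect_exp_walk A η
  have hE2 : 𝔼 e, Real.exp (η * walk A e) ^ 2 = Real.cosh (2 * η) ^ A.card := by
    rw [← expect_exp_walk]
    refine Finset.expect_congr rfl fun e _ => ?_
    rw [← Real.exp_nat_mul]
    push_cast
    ring_nf
  have hpz := paley_zygmund (fun e => Real.exp (η * walk A e)) (θ := 10 / 11)
    (r := Real.exp (-L)) (by norm_num) (by norm_num)
    (by rw [hE]; positivity)
    (by rw [hE2]; exact pow_pos (Real.cosh_pos _) _)
    (by
      rw [hE2, hE, ← hNη, hN, ← mul_neg, Real.exp_nat_mul, ← mul_pow, ← pow_mul, mul_comm _ 2,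
        pow_mul]
      exact pow_le_pow_left₀ (mul_nonneg (Real.exp_pos _).le (Real.cosh_pos _).le)
        (exp_neg_sq_mul_cosh_two_mul_le η) _)
  have hlow : 1 / (363 * b) ≤ (1 - 10 / 11) ^ 2 * Real.exp (-L) := by
    have hb0 : 0 < b := by linarith
    have h3 := Real.exp_one_lt_three
    rw [Real.exp_neg, hL, Real.exp_add, Real.exp_log hb0, ← one_div, mul_one_div,
      div_le_div_iff₀ (by positivity) (by positivity)]
    nlinarith
  refine hlow.trans (hpz.trans (Finset.expect_le_expect fun e _ => ?_))
  rw [hE]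
  by_cases h : 10 / 11 * Real.cosh η ^ A.card ≤ Real.exp (η * walk A e)
  swap
  · rw [if_neg h]; positivity
  rw [if_pos h, if_pos]
  have h1 := Real.log_le_log (by positivity) h
  rw [Real.log_exp, Real.log_mul (by norm_num) (by positivity), Real.log_pow, ← hN] at h1
  have h2 := Real.one_sub_inv_le_log_of_pos (by norm_num : (0 : ℝ) < 10 / 11)
  have h3 : η ^ 2 / 5 ≤ Real.log (Real.cosh η) := by
    refine le_trans ?_ (div_le_log_cosh hη0.le)
    gcongr
    linarith
  have h4 : L / 5 ≤ N * Real.log (Real.cosh η) := by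
    rw [← hNη]
    nlinarith
  rw [hsqrt]
  have h5 : η * (N * η / 10) ≤ η * walk A e := by
    have : η * (N * η / 10) = L / 10 := by rw [← hNη]; ring
    rw [this]
    norm_num at h2
    linarith
  exact le_of_mul_le_mul_left h5 hη0

variable {ι : Type*} [Fintype ι] [DecidableEq ι]

theorem expect_sup'_walk_nonneg (A : Finset τ) {B : Finset ι} (hB : B.Nonempty) :
    0 ≤ 𝔼 x : ι → τ → Bool, B.sup' hB fun i => walk A (x i) := by
  obtain ⟨i, hi⟩ := hB
  rw [← expect_walk A, ← expect_pi_eval i (walk A)]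
  exact Finset.expect_le_expect fun x _ => Finset.le_sup' (fun i => walk A (x i)) hi

theorem le_expect_sup'_walk (A : Finset τ) {B : Finset ι} (hB : B.Nonempty) {b : ℕ} (hb : 2 ≤ b)
    (hbB : b ≤ B.card) (hA : 1 ≤ A.card) (hbA : Real.log b ≤ 2 * A.card) :
    Real.sqrt (A.card * Real.log b) / 7270 ≤
      𝔼 x : ι → τ → Bool, B.sup' hB fun i => walk A (x i) := by
  have hb2 : (2 : ℝ) ≤ b := by exact_mod_cast hb
  set lam := Real.sqrt (A.card * (Real.log b + 1)) / 10 with hlam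
  have hlam0 : 0 ≤ lam := by positivity
  have hanti := anticoncentration_walk A (by linarith : (1 : ℝ) ≤ b) hA hbA
  set p := 𝔼 e, if lam ≤ walk A e then (1 : ℝ) else 0 with hp
  set q : (τ → Bool) → ℝ := fun e => if lam ≤ walk A e then 0 else 1 with hq
  have hEq : 𝔼 e, q e = 1 - p := by
    have : ∀ e, q e = 1 - if lam ≤ walk A e then (1 : ℝ) else 0 := fun e => by
      simp only [hq]; split_ifs <;> simp
    simp_rw [this]
    rw [Finset.expect_sub_distrib, Fintype.expect_const]
  obtain ⟨i₀, hi₀⟩ := hB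
  set B' := B.erase i₀ with hB'
  have hcard : b - 1 ≤ B'.card := by rw [hB', Finset.card_erase_of_mem hi₀]; omega
  -- One walk `i₀` is held in reserve: the supremum is at least `lam` if another walk reaches it,
  -- and at least the walk of `i₀` otherwise. By independence the reserve term averages to zero.
  have hpt : ∀ x : ι → τ → Bool, lam * (1 - ∏ i, if i ∈ B' then q (x i) else 1)
      + ∏ i, (if i = i₀ then walk A (x i) else if i ∈ B' then q (x i) else 1)
      ≤ B.sup' ⟨i₀, hi₀⟩ fun i => walk A (x i) := fun x => by
    have h2 : ∏ i, (if i = i₀ then walk A (x i) else if i ∈ B' then q (x i) else 1)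
        = walk A (x i₀) * ∏ i, if i ∈ B' then q (x i) else 1 := by
      rw [← Finset.mul_prod_erase _ _ (Finset.mem_univ i₀),
        ← Finset.mul_prod_erase _ (fun i => if i ∈ B' then q (x i) else 1) (Finset.mem_univ i₀)]
      simp only [if_true, hB', Finset.notMem_erase, if_false, one_mul]
      congr 1
      exact Finset.prod_congr rfl fun i hi => by rw [if_neg (Finset.ne_of_mem_erase hi)]
    rw [h2]
    by_cases h : ∃ i ∈ B', lam ≤ walk A (x i)
    · obtain ⟨i, hi, hl⟩ := h
      rw [Finset.prod_eq_zero (Finset.mem_univ i) (by simp [hi, hq, hl])]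
      have := Finset.le_sup' (fun i => walk A (x i)) (Finset.mem_of_mem_erase hi)
      linarith
    · push Not at h
      rw [Finset.prod_eq_one fun i _ => ?_]
      · have := Finset.le_sup' (fun i => walk A (x i)) hi₀
        linarith
      · by_cases hi : i ∈ B'
        · simp [hi, hq, h i hi]
        · simp [hi]
  refine le_trans ?_ (Finset.expect_le_expect fun x _ => hpt x)
  rw [Finset.expect_add_distrib, ← Finset.mul_expect, Finset.expect_sub_distrib,
    Fintype.expect_const,
    expect_pi_prod fun i e => if i = i₀ then walk A e else if i ∈ B' then q e else 1,
    expect_pi_prod fun i e => if i ∈ B' then q e else 1,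
    Finset.prod_eq_zero (f := fun i => 𝔼 e, if i = i₀ then walk A e else
      if i ∈ B' then q e else 1) (Finset.mem_univ i₀) (by simp [expect_walk]), add_zero]
  have h1 : ∀ i, (𝔼 e, if i ∈ B' then q e else 1) = if i ∈ B' then 1 - p else 1 := fun i => by
    split_ifs
    · exact hEq
    · simp
  simp_rw [h1]
  rw [Finset.prod_ite_mem, Finset.univ_inter, Finset.prod_const]
  have hp1 : 0 ≤ 1 - p := by
    rw [← hEq]
    exact Finset.expect_nonneg fun e _ => by simp only [hq]; split_ifs <;> simp
  have h2 : (1 - p) ^ B'.card ≤ 726 / 727 := by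
    have hcb : (b : ℝ) ≤ B'.card + 1 := by exact_mod_cast (by omega : b ≤ B'.card + 1)
    have h3 : 1 / 726 ≤ B'.card * p := by
      have h4 : (b : ℝ) / 2 * (1 / (363 * b)) ≤ B'.card * p := by
        gcongr
        linarith
      have h5 : (b : ℝ) / 2 * (1 / (363 * b)) = 1 / 726 := by field_simp; norm_num
      linarith
    calc (1 - p) ^ B'.card ≤ Real.exp (-p) ^ B'.card := by
          gcongr
          linarith [Real.add_one_le_exp (-p)]
      _ = Real.exp (-(B'.card * p)) := by rw [← Real.exp_nat_mul]; ring_nf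
      _ ≤ Real.exp (-(1 / 726)) := by gcongr
      _ ≤ 726 / 727 := by
          rw [Real.exp_neg, inv_le_comm₀ (Real.exp_pos _) (by norm_num)]
          have := Real.add_one_le_exp (1 / 726 : ℝ)
          norm_num at this ⊢
          linarith
  have h3 : Real.sqrt (A.card * Real.log b) ≤ 10 * lam := by
    rw [hlam, mul_div_cancel₀ _ (by norm_num)]
    gcongr
    linarith
  nlinarith

end Walk

/-! ### Players against independent random loss vectors -/

section Random

variable {n k T : ℕ}

/-- The player obtained by stopping before the last round. -/
def Player.init (σ : Player n k (T + 1)) : Player n k T := fun t => σ t.castSucc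

theorem playProb_snoc (σ : Player n k (T + 1)) (ℓ : Fin T → LossVector n) (v : LossVector n)
    (s : Fin T → KSubset n k) (S : KSubset n k) :
    playProb σ (Fin.snoc (α := fun _ => LossVector n) ℓ v)
      (Fin.snoc (α := fun _ => KSubset n k) s S) =
      playProb σ.init ℓ s * (σ (Fin.last T) ℓ s).1 S := by
  have h : ∀ {α : Type} (x : Fin T → α) (a : α) (t : Fin T),
      past (Fin.snoc (α := fun _ => α) x a) t.castSucc = past x t := fun x a t => by
    funext r
    exact Fin.snoc_castSucc (α := fun _ => _) a x (Fin.castLE t.isLt.le r)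
  have h' : ∀ {α : Type} (x : Fin T → α) (a : α),
      past (Fin.snoc (α := fun _ => α) x a) (Fin.last T) = x := fun x a => by
    funext r
    exact Fin.snoc_castSucc (α := fun _ => _) a x r
  unfold playProb
  rw [Fin.prod_univ_castSucc]
  simp only [Fin.snoc_castSucc, Fin.snoc_last, h, h']
  rfl

theorem sum_snoc {α : Type} [Fintype α] (f : (Fin (T + 1) → α) → ℝ) :
    ∑ x, f x = ∑ x : Fin T → α, ∑ a, f (Fin.snoc (α := fun _ => α) x a) := by
  rw [← (Fin.snocEquiv fun _ : Fin (T + 1) => α).sum_comp, Fintype.sum_prod_type,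
    Finset.sum_comm]
  rfl

theorem expect_snoc {α : Type} [Fintype α] (f : (Fin (T + 1) → α) → ℝ) :
    𝔼 x, f x = 𝔼 x : Fin T → α, 𝔼 a, f (Fin.snoc (α := fun _ => α) x a) := by
  simp only [Fintype.expect_eq_sum_div_card, sum_snoc, ← Finset.sum_div, div_div]
  simp [pow_succ, mul_comm]

theorem sum_playProb (σ : Player n k T) (ℓ : Fin T → LossVector n) :
    ∑ s, playProb σ ℓ s = 1 := by
  induction T with
  | zero => simp [playProb]
  | succ T ih =>
    rw [← Fin.snoc_init_self ℓ, sum_snoc]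
    simp_rw [playProb_snoc, ← Finset.mul_sum]
    rw [← ih σ.init (Fin.init ℓ)]
    refine Finset.sum_congr rfl fun s _ => ?_
    rw [(σ (Fin.last T) _ s).2.2, mul_one]

theorem expectedLoss_snoc (σ : Player n k (T + 1)) (ℓ : Fin T → LossVector n)
    (v : LossVector n) :
    expectedLoss σ (Fin.snoc (α := fun _ => LossVector n) ℓ v) = expectedLoss σ.init ℓ
      + ∑ s, playProb σ.init ℓ s * ∑ S, (σ (Fin.last T) ℓ s).1 S * setLoss v S := by
  unfold expectedLoss
  rw [sum_snoc, ← Finset.sum_add_distrib]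
  refine Finset.sum_congr rfl fun s _ => ?_
  simp_rw [playProb_snoc, Fin.sum_univ_castSucc, Fin.snoc_castSucc, Fin.snoc_last, mul_add,
    Finset.sum_add_distrib, mul_assoc, ← Finset.mul_sum]
  congr 2
  rw [← Finset.sum_mul, (σ (Fin.last T) ℓ s).2.2, one_mul]

/-- If every `k`-subset has mean loss at least `a` in a random loss vector, then every player
has mean loss at least `a` per round against independent copies of it. -/
theorem le_expect_expectedLoss {W : Type} [Fintype W] [Nonempty W] (g : W → LossVector n) {a : ℝ}
    (ha : ∀ S : KSubset n k, a ≤ 𝔼 w, setLoss (g w) S) (σ : Player n k T) :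
    T * a ≤ 𝔼 ω : Fin T → W, expectedLoss σ fun t => g (ω t) := by
  induction T with
  | zero => simp [expectedLoss]
  | succ T ih =>
    rw [expect_snoc]
    have h : ∀ (ω : Fin T → W) (w : W),
        (fun t => g (Fin.snoc (α := fun _ => W) ω w t))
          = Fin.snoc (α := fun _ => LossVector n) (fun t => g (ω t)) (g w) := fun ω w => by
      funext t
      refine Fin.lastCases ?_ (fun t => ?_) t <;> simp
    simp_rw [h, expectedLoss_snoc, Finset.expect_add_distrib, Fintype.expect_const]
    push_cast
    rw [add_mul, one_mul]
    refine add_le_add (ih σ.init) ?_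
    refine le_trans (Fintype.expect_const (ι := Fin T → W) a).ge
      (Finset.expect_le_expect fun ω _ => ?_)
    -- Given the history, the last loss vector is independent of the set played, so the player's
    -- mixture of means is at least `a`.
    rw [Finset.expect_sum_comm, ← one_mul a, ← sum_playProb σ.init fun t => g (ω t),
      Finset.sum_mul]
    refine Finset.sum_le_sum fun s _ => ?_
    rw [← Finset.mul_expect]
    refine mul_le_mul_of_nonneg_left ?_ (playProb_nonneg _ _ _)
    rw [Finset.expect_sum_comm, ← one_mul a,
      ← (σ (Fin.last T) (fun t => g (ω t)) s).2.2, Finset.sum_mul]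
    refine Finset.sum_le_sum fun S _ => ?_
    rw [← Finset.mul_expect]
    exact mul_le_mul_of_nonneg_left (ha S) ((σ (Fin.last T) _ s).2.1 S)

theorem le_minimaxRegret {W : Type} [Fintype W] [Nonempty W] (hk : 1 ≤ k) (hkn : k ≤ n)
    (g : W → LossVector n) {a b : ℝ} (ha : ∀ S : KSubset n k, a ≤ 𝔼 w, setLoss (g w) S)
    (hb : 𝔼 ω : Fin T → W, bestStaticLoss k (fun t => g (ω t)) ≤ b) :
    T * a - b ≤ minimaxRegret n k T := by
  have := nonempty_kSubset hkn
  have : Nonempty (Player n k T) := ⟨hedgePlayer 0⟩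
  refine le_ciInf fun σ => ?_
  have h1 := le_expect_expectedLoss (T := T) g ha σ
  have h2 : 𝔼 ω : Fin T → W, regret σ (fun t => g (ω t)) ≤ ⨆ ℓ, regret σ ℓ := by
    refine Finset.expect_le Finset.univ_nonempty fun ω _ => ?_
    exact le_ciSup (bddAbove_regret hk σ) fun t => g (ω t)
  unfold regret at h2
  rw [Finset.expect_sub_distrib] at h2
  unfold regret
  linarith

end Random

/-! ### The random block construction -/

section Block

variable {n k T : ℕ}

/-- The losses of a round in which only the actions of block `w.1` are active; `w.2` tells
which of them have loss `0`. -/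
def blockLoss (f : Fin n → Fin k) (w : Fin k × (Fin n → Bool)) : LossVector n :=
  fun i => if f i = w.1 then (if w.2 i then ⟨0, by simp⟩ else ⟨1, by simp⟩) else ⟨1, by simp⟩

theorem coe_blockLoss (f : Fin n → Fin k) (w : Fin k × (Fin n → Bool)) (i : Fin n) :
    (blockLoss f w i : ℝ) = 1 - if f i = w.1 then (1 + sgn (w.2 i)) / 2 else 0 := by
  unfold blockLoss sgn
  split_ifs <;> norm_num

theorem le_expect_setLoss_blockLoss (hk : 1 ≤ k) (f : Fin n → Fin k) (S : KSubset n k) :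
    1 / 2 ≤ 𝔼 w, setLoss (blockLoss f w) S := by
  have hk0 : (0 : ℝ) < k := by exact_mod_cast hk
  have : Nonempty (Fin k) := ⟨⟨0, hk⟩⟩
  have h1 : ∀ w, 1 - ∑ i ∈ S.1, (1 - (blockLoss f w i : ℝ)) ≤ setLoss (blockLoss f w) S :=
    fun w => by
      refine le_setLoss hk _ S fun i hi => ?_
      have := Finset.single_le_sum (f := fun i => 1 - (blockLoss f w i : ℝ))
        (fun i _ => sub_nonneg.2 (blockLoss f w i).2.2) hi
      linarith
  refine le_trans ?_ (Finset.expect_le_expect fun w _ => h1 w)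
  have h2 : ∀ i, 𝔼 w, (1 - (blockLoss f w i : ℝ)) = 1 / (2 * k) := fun i => by
    simp only [coe_blockLoss, sub_sub_cancel]
    rw [expect_prod]
    have h3 : ∀ j : Fin k, (𝔼 x : Fin n → Bool, if f i = j then (1 + sgn (x i)) / 2 else 0)
        = if f i = j then 1 / 2 else 0 := fun j => by
      split_ifs
      · rw [expect_pi_eval i fun b => (1 + sgn b) / 2, expect_bool]
        norm_num [sgn]
      · simp
    simp_rw [h3]
    rw [Fintype.expect_eq_sum_div_card]
    simp
    field_simp
  rw [Finset.expect_sub_distrib, Fintype.expect_const, Finset.expect_sum_comm]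
  simp_rw [h2]
  rw [Finset.sum_const, S.2, nsmul_eq_mul]
  have : (k : ℝ) * (1 / (2 * k)) = 1 / 2 := by field_simp
  rw [this]
  norm_num

/-- The block of actions sent to `j`. -/
def block (f : Fin n → Fin k) (j : Fin k) : Finset (Fin n) := Finset.univ.filter fun i => f i = j

theorem block_nonempty {f : Fin n → Fin k} (hf : Function.Surjective f) (j : Fin k) :
    (block f j).Nonempty := by
  obtain ⟨i, hi⟩ := hf j
  exact ⟨i, by simp [block, hi]⟩

/-- The rounds in which block `j` is active. -/
def activeRounds (a : Fin T → Fin k) (j : Fin k) : Finset (Fin T) :=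
  Finset.univ.filter fun t => a t = j

theorem bestStaticLoss_blockLoss_le {f : Fin n → Fin k} (hf : Function.Surjective f)
    (ω : Fin T → Fin k × (Fin n → Bool)) :
    bestStaticLoss k (fun t => blockLoss f (ω t)) ≤ T / 2 - (∑ j,
      (block f j).sup' (block_nonempty hf j) fun i =>
        walk (activeRounds (fun t => (ω t).1) j) fun t => (ω t).2 i) / 2 := by
  -- The comparator takes a best action from each block; the blocks are disjoint, so it has exactly
  -- `k` elements.
  choose c hc hmax using fun j => Finset.exists_mem_eq_sup' (block_nonempty hf j) fun i =>
        walk (activeRounds (fun t => (ω t).1) j) fun t => (ω t).2 i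
  simp_rw [hmax]
  have hfc : ∀ j, f (c j) = j := fun j => by simpa [block] using hc j
  have hinj : Function.Injective c := fun i j h => by rw [← hfc i, h, hfc]
  let S : KSubset n k := ⟨Finset.univ.image c, by
    rw [Finset.card_image_of_injective _ hinj]; simp⟩
  refine (bestStaticLoss_le _ S).trans ?_
  have h1 : ∀ t, setLoss (blockLoss f (ω t)) S ≤ 1 / 2 - sgn ((ω t).2 (c (ω t).1)) / 2 :=
    fun t => by
      refine (setLoss_le _ S (i := c (ω t).1) (by simp [S])).trans ?_
      rw [coe_blockLoss, if_pos (hfc _)]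
      linarith
  refine (Finset.sum_le_sum fun t _ => h1 t).trans (le_of_eq ?_)
  have h2 : ∑ _t : Fin T, (1 / 2 : ℝ) = T / 2 := by simp; ring
  rw [Finset.sum_sub_distrib, h2, ← Finset.sum_div]
  congr 2
  · rw [← Finset.sum_fiberwise _ fun t => (ω t).1]
    refine Finset.sum_congr rfl fun j _ => Finset.sum_congr rfl fun t ht => ?_
    have htj : (ω t).1 = j := (Finset.mem_filter.1 ht).2
    rw [htj]

/-- Coins are drawn for inactive actions too, so the active blocks are independent of all coins, and
conditioning on them leaves the walks independent. -/
theorem expect_block {F : (Fin T → Fin k) → (Fin n → Fin T → Bool) → ℝ} :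
    𝔼 ω : Fin T → Fin k × (Fin n → Bool), F (fun t => (ω t).1) (fun i t => (ω t).2 i)
      = 𝔼 a, 𝔼 x, F a x := by
  rw [← expect_prod fun p : (Fin T → Fin k) × (Fin n → Fin T → Bool) => F p.1 p.2]
  exact Fintype.expect_equiv ((Equiv.arrowProdEquivProdArrow _ _ _).trans
    (Equiv.prodCongr (Equiv.refl _) (Equiv.piComm _))) _ _ fun ω => rfl

/-- A block is active in at least half the expected number of rounds, with a probability
bounded below. -/
theorem le_expect_card_activeRounds (hk : 1 ≤ k) (j : Fin k) :
    1 - Real.exp (-((T : ℝ) / k / 8)) ≤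
      𝔼 a : Fin T → Fin k, if (T : ℝ) / k / 2 ≤ (activeRounds a j).card then (1 : ℝ) else 0 := by
  have hk0 : (0 : ℝ) < k := by exact_mod_cast hk
  have : Nonempty (Fin k) := ⟨j⟩
  -- Chernoff bound for the lower tail with parameter `1`. As `1 - exp (-1) > 5 / 8`, the exponent
  -- is `1 / 2 - 5 / 8 = -1 / 8` times `T / k`.
  have h1 : ∀ a : Fin T → Fin k, 1 - Real.exp ((T : ℝ) / k / 2)
      * ∏ t, (if a t = j then Real.exp (-1) else 1)
      ≤ if (T : ℝ) / k / 2 ≤ (activeRounds a j).card then (1 : ℝ) else 0 := fun a => by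
    rw [Finset.prod_ite, Finset.prod_const, Finset.prod_const_one, mul_one, ← Real.exp_nat_mul,
      ← Real.exp_add]
    split_ifs with h
    · linarith [Real.exp_pos ((T : ℝ) / k / 2 + (Finset.univ.filter fun t => a t = j).card * -1)]
    · have := Real.one_le_exp (x := (T : ℝ) / k / 2
        + (Finset.univ.filter fun t => a t = j).card * -1) (by
          unfold activeRounds at h; linarith)
      linarith
  refine le_trans ?_ (Finset.expect_le_expect fun a _ => h1 a)
  rw [Finset.expect_sub_distrib, Fintype.expect_const, ← Finset.mul_expect,
    expect_pi_prod fun _ e => if e = j then Real.exp (-1) else 1, Finset.prod_const,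
    Finset.card_univ, Fintype.card_fin]
  have h2 : (𝔼 e : Fin k, if e = j then Real.exp (-1) else 1) = 1 - (1 - Real.exp (-1)) / k := by
    have : ∀ e, (if e = j then Real.exp (-1) else 1)
        = 1 - if e = j then 1 - Real.exp (-1) else 0 := fun e => by split_ifs <;> ring
    simp_rw [this]
    rw [Finset.expect_sub_distrib, Fintype.expect_const, Fintype.expect_eq_sum_div_card]
    simp
  have h3 : Real.exp (-1) < 3 / 8 := Real.exp_neg_one_lt_d9.trans (by norm_num)
  have h4 : (𝔼 e : Fin k, if e = j then Real.exp (-1) else 1) ≤ Real.exp (-(5 / 8 / k)) := by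
    rw [h2]
    have h5 := Real.add_one_le_exp (-(5 / 8 / k : ℝ))
    have h6 : (5 / 8 : ℝ) / k ≤ (1 - Real.exp (-1)) / k := by gcongr; linarith
    linarith
  have h7 : 0 ≤ 𝔼 e : Fin k, if e = j then Real.exp (-1) else 1 :=
    Finset.expect_nonneg fun e _ => by split_ifs <;> positivity
  have h8 := mul_le_mul_of_nonneg_left (pow_le_pow_left₀ h7 h4 T)
    (Real.exp_pos ((T : ℝ) / k / 2)).le
  rw [← Real.exp_nat_mul, ← Real.exp_add] at h8
  have h9 : (T : ℝ) / k / 2 + T * -(5 / 8 / k) = -((T : ℝ) / k / 8) := by ring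
  rw [h9] at h8
  linarith

theorem le_expect_sup'_activeRounds {f : Fin n → Fin k} (hf : Function.Surjective f) (hk : 1 ≤ k)
    (hT : 1 ≤ T) {j : Fin k} {b : ℕ} (hb : 2 ≤ b) (hbj : b ≤ (block f j).card)
    (hbT : b = 2 ∨ Real.log b ≤ (T : ℝ) / k) :
    (1 - Real.exp (-((T : ℝ) / k / 8))) * (Real.sqrt ((T : ℝ) / k / 2 * Real.log b) / 7270) ≤
      𝔼 a : Fin T → Fin k, 𝔼 x : Fin n → Fin T → Bool,
        (block f j).sup' (block_nonempty hf j) fun i => walk (activeRounds a j) (x i) := by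
  have hk0 : (0 : ℝ) < k := by exact_mod_cast hk
  have hT0 : (0 : ℝ) < T := by exact_mod_cast hT
  refine (mul_le_mul_of_nonneg_right (le_expect_card_activeRounds hk j) (by positivity)).trans ?_
  rw [Finset.expect_mul]
  refine Finset.expect_le_expect fun a _ => ?_
  split_ifs with h
  · have hpos : (0 : ℝ) < (activeRounds a j).card := lt_of_lt_of_le (by positivity) h
    have hA : 1 ≤ (activeRounds a j).card := by exact_mod_cast hpos
    have hA' : (1 : ℝ) ≤ (activeRounds a j).card := by exact_mod_cast hA
    rw [one_mul]
    refine le_trans ?_ (le_expect_sup'_walk _ (block_nonempty hf j) hb hbj hA ?_)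
    · have : 0 ≤ Real.log b := Real.log_natCast_nonneg b
      gcongr
    -- The case `b = 2` is separate because `log 2 ≤ T / k` can fail when `n / k` is near `1`; one
    -- active round is then enough.
    · rcases hbT with rfl | hbT
      · have := Real.log_two_lt_d9
        push_cast
        linarith
      · linarith
  · rw [zero_mul]
    exact expect_sup'_walk_nonneg _ _

theorem le_minimaxRegret_of_blocks {f : Fin n → Fin k} (hf : Function.Surjective f) (hk : 1 ≤ k)
    (hkn : k ≤ n) (hT : 1 ≤ T) (J : Finset (Fin k)) {b : ℕ} (hb : 2 ≤ b)
    (hbJ : ∀ j ∈ J, b ≤ (block f j).card) (hbT : b = 2 ∨ Real.log b ≤ (T : ℝ) / k) :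
    J.card * ((1 - Real.exp (-((T : ℝ) / k / 8)))
      * (Real.sqrt ((T : ℝ) / k / 2 * Real.log b) / 7270)) / 2 ≤ minimaxRegret n k T := by
  have : Nonempty (Fin k) := ⟨⟨0, hk⟩⟩
  set B := (1 - Real.exp (-((T : ℝ) / k / 8)))
      * (Real.sqrt ((T : ℝ) / k / 2 * Real.log b) / 7270)
  have h := le_minimaxRegret (T := T) hk hkn (blockLoss f) (le_expect_setLoss_blockLoss hk f)
    (b := T / 2 - J.card * B / 2) ?_
  · linarith
  refine (Finset.expect_le_expect fun ω _ => bestStaticLoss_blockLoss_le hf ω).trans ?_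
  rw [Finset.expect_sub_distrib, Fintype.expect_const, ← Finset.expect_div,
    Finset.expect_sum_comm]
  have h1 : ∀ j, (𝔼 ω : Fin T → Fin k × (Fin n → Bool),
      (block f j).sup' (block_nonempty hf j) fun i =>
        walk (activeRounds (fun t => (ω t).1) j) fun t => (ω t).2 i)
      = 𝔼 a : Fin T → Fin k, 𝔼 x : Fin n → Fin T → Bool,
        (block f j).sup' (block_nonempty hf j) fun i => walk (activeRounds a j) (x i) :=
    fun j => expect_block (F := fun a x => (block f j).sup' (block_nonempty hf j) fun i =>
      walk (activeRounds a j) (x i))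
  simp_rw [h1]
  have h2 : J.card * B ≤ ∑ j, 𝔼 a : Fin T → Fin k, 𝔼 x : Fin n → Fin T → Bool,
        (block f j).sup' (block_nonempty hf j) fun i => walk (activeRounds a j) (x i) := by
    rw [← nsmul_eq_mul]
    refine (Finset.card_nsmul_le_sum J _ _ fun j hj =>
      le_expect_sup'_activeRounds hf hk hT hb (hbJ j hj) hbT).trans ?_
    exact Finset.sum_le_sum_of_subset_of_nonneg (Finset.subset_univ _) fun j _ _ =>
      Finset.expect_nonneg fun a _ => expect_sup'_walk_nonneg _ _
  linarith

end Block

/-! ### Residue blocks and the lower bound -/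

section Lower

variable {n k T : ℕ}

/-- The residue of an action modulo `k`. -/
def residue (n : ℕ) (hk : 1 ≤ k) (i : Fin n) : Fin k := ⟨i % k, Nat.mod_lt _ hk⟩

theorem residue_surjective (hk : 1 ≤ k) (hkn : k ≤ n) : Function.Surjective (residue n hk) :=
  fun j => ⟨⟨j, j.2.trans_le hkn⟩, Fin.ext (Nat.mod_eq_of_lt j.2)⟩

theorem le_card_block_residue (hk : 1 ≤ k) {j : Fin k} {b : ℕ}
    (hj : (j : ℕ) + k * (b - 1) < n) : b ≤ (block (residue n hk) j).card := by
  have hlt : ∀ q : Fin b, (j : ℕ) + k * q < n := fun q =>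
    lt_of_le_of_lt (by gcongr; omega) hj
  have hinj : Function.Injective fun q : Fin b => (⟨j + k * q, hlt q⟩ : Fin n) := fun q r h => by
    have h1 : (j : ℕ) + k * q = j + k * r := congrArg Fin.val h
    exact Fin.ext (Nat.eq_of_mul_eq_mul_left hk (by omega))
  have : (Finset.univ.image fun q : Fin b => (⟨j + k * q, hlt q⟩ : Fin n))
      ⊆ block (residue n hk) j := by
    intro i hi
    obtain ⟨q, -, rfl⟩ := Finset.mem_image.1 hi
    simp only [block, Finset.mem_filter, Finset.mem_univ, true_and]
    exact Fin.ext (by simp [residue, Nat.mod_eq_of_lt j.2])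
  simpa [Finset.card_image_of_injective _ hinj] using Finset.card_le_card this

/-- There are many residue blocks whose size has logarithm comparable to `log (n / k)`. -/
theorem exists_blocks (hk : 1 ≤ k) {ρ : ℝ} (hρ : 1 < ρ) (hn : ρ * k ≤ n) :
    ∃ (J : Finset (Fin k)) (b : ℕ), 2 ≤ b ∧ (∀ j ∈ J, b ≤ (block (residue n hk) j).card) ∧
      (b = 2 ∨ Real.log b ≤ Real.log ((n : ℝ) / k)) ∧
      Real.log ((n : ℝ) / k) ≤ 2 * Real.log b ∧ min 1 (ρ - 1) * k ≤ J.card := by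
  have hk0 : (0 : ℝ) < k := by exact_mod_cast hk
  have hn0 : (0 : ℝ) < n := lt_of_lt_of_le (by positivity) hn
  rcases le_or_gt (2 * k) n with h | h
  · have hb : 2 ≤ n / k := (Nat.le_div_iff_mul_le hk).2 h
    have hb' : (2 : ℝ) ≤ (n / k : ℕ) := by exact_mod_cast hb
    refine ⟨Finset.univ, n / k, hb, fun j _ => le_card_block_residue hk ?_, Or.inr ?_, ?_, ?_⟩
    · have h1 := Nat.mul_div_le n k
      have h2 : k * (n / k - 1) + k = k * (n / k) := by
        rw [← Nat.mul_succ]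
        congr 1
        omega
      have := j.2
      omega
    · exact Real.log_le_log (by linarith) Nat.cast_div_le
    · rw [← Nat.cast_ofNat (n := 2), ← Real.log_pow]
      refine Real.log_le_log (by positivity) ?_
      have h1 : (n : ℝ) / k < (n / k : ℕ) + 1 := by
        rw [div_lt_iff₀ hk0, mul_comm]
        exact_mod_cast Nat.lt_mul_div_succ n hk
      -- With `b = n / k` rounded down and `b ≥ 2`, the quotient is below `b + 1 ≤ b ^ 2`.
      nlinarith
    · simp only [Finset.card_univ, Fintype.card_fin]
      nlinarith [min_le_left 1 (ρ - 1)]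
  · have hkn : k ≤ n := by
      have : (k : ℝ) ≤ n := by nlinarith
      exact_mod_cast this
    -- Below `2 * k` actions, only the residues `j < n - k` have a second representative; there are
    -- at least `(ρ - 1) * k` of them.
    refine ⟨Finset.univ.filter fun j : Fin k => (j : ℕ) + k * (2 - 1) < n, 2, le_rfl,
      fun j hj => le_card_block_residue hk (Finset.mem_filter.1 hj).2, Or.inl rfl, ?_, ?_⟩
    · have h1 : Real.log ((n : ℝ) / k) ≤ Real.log 2 := by
        refine Real.log_le_log (by positivity) ?_
        rw [div_le_iff₀ hk0]
        exact_mod_cast h.le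
      have := Real.log_pos one_lt_two
      push_cast
      linarith
    · have h1 : n - k ≤ (Finset.univ.filter fun j : Fin k => (j : ℕ) + k * (2 - 1) < n).card := by
        have hinj : Function.Injective fun q : Fin (n - k) => (⟨q, by omega⟩ : Fin k) :=
          fun q r h => Fin.ext (Fin.mk.inj_iff.1 h)
        have hsub : (Finset.univ.image fun q : Fin (n - k) => (⟨q, by omega⟩ : Fin k))
            ⊆ Finset.univ.filter fun j : Fin k => (j : ℕ) + k * (2 - 1) < n := by
          intro j hj
          obtain ⟨q, -, rfl⟩ := Finset.mem_image.1 hj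
          have := q.2
          simp only [Finset.mem_filter, Finset.mem_univ, true_and]
          omega
        simpa [Finset.card_image_of_injective _ hinj] using Finset.card_le_card hsub
      have h2 : (n : ℝ) - k
          ≤ ((Finset.univ.filter fun j : Fin k => (j : ℕ) + k * (2 - 1) < n).card : ℕ) := by
        rw [← Nat.cast_sub hkn]
        exact_mod_cast h1
      nlinarith [min_le_right 1 (ρ - 1)]

theorem sqrt_le_minimaxRegret {ρ : ℝ} (hρ : 1 < ρ) (hk : 1 ≤ k) (hn : ρ * k ≤ n)
    (hT : k * Real.log ((n : ℝ) / k) ≤ T) :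
    min 1 (ρ - 1) * (1 - Real.exp (-(Real.log ρ / 8))) / 29080
      * Real.sqrt (k * T * Real.log ((n : ℝ) / k)) ≤ minimaxRegret n k T := by
  have hk0 : (0 : ℝ) < k := by exact_mod_cast hk
  have hkn : k ≤ n := by
    have : (k : ℝ) ≤ n := by nlinarith
    exact_mod_cast this
  have hlogρ := Real.log_pos hρ
  have hlog : Real.log ρ ≤ Real.log ((n : ℝ) / k) :=
    Real.log_le_log (by linarith) (by rwa [le_div_iff₀ hk0])
  have hτ : Real.log ((n : ℝ) / k) ≤ (T : ℝ) / k := by rwa [le_div_iff₀' hk0]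
  have hT0 : (0 : ℝ) < T := lt_of_lt_of_le (mul_pos hk0 (by linarith)) hT
  obtain ⟨J, b, hb, hbJ, hbT, hlogb, hJ⟩ := exists_blocks hk hρ hn
  refine le_trans ?_ (le_minimaxRegret_of_blocks (residue_surjective hk hkn) hk hkn
    (by exact_mod_cast hT0) J hb hbJ (hbT.imp_right fun h => h.trans hτ))
  set lg := Real.log ((n : ℝ) / k)
  have h1 : Real.sqrt (k * T * lg) = k * (2 * Real.sqrt ((T : ℝ) / k / 2 * (lg / 2))) := by
    have : (k : ℝ) * T * lg = (k * 2) ^ 2 * ((T : ℝ) / k / 2 * (lg / 2)) := by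
      field_simp
    rw [this, Real.sqrt_mul (by positivity), Real.sqrt_sq (by positivity)]
    ring
  have h2 : Real.sqrt ((T : ℝ) / k / 2 * (lg / 2)) ≤ Real.sqrt ((T : ℝ) / k / 2 * Real.log b) := by
    gcongr
    linarith
  -- The horizon hypothesis gives `T / k ≥ log (n / k) ≥ log ρ`, so the Chernoff factor is bounded
  -- below in terms of `ρ` alone.
  have h3 : 1 - Real.exp (-(Real.log ρ / 8)) ≤ 1 - Real.exp (-((T : ℝ) / k / 8)) := by
    gcongr
    exact hlog.trans hτ
  have h4 : 0 ≤ 1 - Real.exp (-(Real.log ρ / 8)) := by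
    rw [sub_nonneg, Real.exp_le_one_iff]
    linarith
  rw [h1]
  calc _ = min 1 (ρ - 1) * k * ((1 - Real.exp (-(Real.log ρ / 8)))
        * (Real.sqrt ((T : ℝ) / k / 2 * (lg / 2)) / 7270)) / 2 := by ring
    _ ≤ _ := by gcongr; exact h4.trans h3

end Lower

end BestOfK

end

theorem mainTheorem12 :
    (∃ C : ℝ, 0 < C ∧ ∀ n k T : ℕ, 1 ≤ k → k ≤ n →
      BestOfK.minimaxRegret n k T ≤ C * Real.sqrt (k * T * Real.log ((n : ℝ) / k))) ∧
    (∀ ρ : ℝ, 1 < ρ → ∃ c : ℝ, 0 < c ∧ ∀ n k T : ℕ, 1 ≤ k → ρ * k ≤ n →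
      k * Real.log ((n : ℝ) / k) ≤ T →
      c * Real.sqrt (k * T * Real.log ((n : ℝ) / k)) ≤ BestOfK.minimaxRegret n k T) := by
  refine ⟨⟨16, by norm_num, fun n k T hk hkn => BestOfK.minimaxRegret_le_sqrt hk hkn⟩,
    fun ρ hρ => ⟨min 1 (ρ - 1) * (1 - Real.exp (-(Real.log ρ / 8))) / 29080, ?_,
      fun n k T hk hn hT => BestOfK.sqrt_le_minimaxRegret hρ hk hn hT⟩⟩
  have h1 : 0 < min 1 (ρ - 1) := lt_min one_pos (by linarith)
  have h2 : 0 < 1 - Real.exp (-(Real.log ρ / 8)) := by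
    have := Real.log_pos hρ
    rw [sub_pos, Real.exp_lt_one_iff]
    linarith
  positivity
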